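/- Let $X_1,X_2,\dots$ be independent real random variables with common probability density $f$ vanishing on $(-\infty,0)$, and let $c>0$. Assume that $f$ is twice differentiable on $(0,c)\cup(c,\infty)$ and that, for some $\varsigma\in(0,1]$ and $L<\infty$, $|f''(s)-f''(t)|\le L|s-t|^{\varsigma}$ whenever $s,t\in(0,c)$ or $s,t\in(c,\infty)$; that the one-sided limits $f_-(c)=\lim_{x\uparrow c}f(x)$ and $f_+(c)=\lim_{x\downarrow c}f(x)$ exist and are positive; and that $f'$ and $f''$ have finite one-sided limits at $c$ from both sides. Let $b=b_n>0$ be a deterministic sequence with $b+(nb)^{-1}\to0$, and fix $\delta\in(0,1)$. Write $\gamma(a,z)=\int_0^z t^{a-1}e^{-t}\,dt$ and $\Gamma(a,z)=\int_z^\infty t^{a-1}e^{-t}\,dt$. Based on $X_1,\dots,X_n$ and a smoothing parameter $h>0$, let $$\hat f_{-,h}(c)=\frac1n\sum_{i=1}^n\frac{X_i^{c/h}e^{-X_i/h}\mathbf 1\{0\le X_i<c\}}{h^{c/h+1}\gamma(c/h+1,c/h)},\qquad \hat f_{+,h}(c)=\frac1n\sum_{i=1}^n\frac{X_i^{c/h}e^{-X_i/h}\mathbf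 1\{X_i\ge c\}}{h^{c/h+1}\Gamma(c/h+1,c/h)},$$ $$\tilde f_\pm(c)=\{\hat f_{\pm,b}(c)\}^{1/(1-\delta^{1/2})}\{\hat f_{\pm,b/\delta}(c)\}^{-\delta^{1/2}/(1-\delta^{1/2})},\qquad \tilde J(c)=\tilde f_+(c)-\tilde f_-(c).$$ Let $J(c)=f_+(c)-f_-(c)$ and $$V(c)=\lambda(\delta)\,\frac{f_+(c)+f_-(c)}{\sqrt\pi\,c^{1/2}},\qquad \lambda(\delta)=\frac{(1+\delta^{3/2})(1+\delta)^{1/2}-2\sqrt2\,\delta}{(1+\delta)^{1/2}(1-\delta^{1/2})^2}.$$ Let $\tilde V(c)=\tilde V_n(c)$ be any sequence of random variables with $\tilde V(c)\to V(c)$ in probability, and let $$T(c)=\frac{\sqrt{n b^{1/2}}\,\tilde J(c)}{\sqrt{\tilde V(c)}} .$$ Suppose that $J(c)\ne0$. Then for every deterministic sequence $B_n=o(n^{1/2}b^{1/4})$, $$\Pr\{|T(c)|>B_n\}\to1\quad\text{as } n\to\infty .$$ The same holds when the variance estimator $\tilde V(c)$ in $T(c)$ is $$\tilde V_1(c)=\lambda(\delta)\frac{\tilde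 f_+(c)+\tilde f_-(c)}{\sqrt\pi\,c^{1/2}}\quad\text{or}\quad \tilde V_2(c)=\lambda(\delta)\frac{2\hat f(c)}{\sqrt\pi\,c^{1/2}},\qquad \hat f(c)=\frac1n\sum_{i=1}^n\frac{X_i^{c/b}e^{-X_i/b}\mathbf 1\{X_i\ge0\}}{b^{c/b+1}\Gamma(c/b+1)} .$$ -/

import Mathlib

open MeasureTheory ProbabilityTheory Filter Topology Asymptotics Set
open scoped NNReal

noncomputable section

/-- Lower incomplete gamma function `γ(a, z) = ∫₀^z t^(a-1) e^(-t) dt`. -/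
def lowerGamma (a z : ℝ) : ℝ := ∫ t in Ioc 0 z, t ^ (a - 1) * Real.exp (-t)

/-- Upper incomplete gamma function `Γ(a, z) = ∫_z^∞ t^(a-1) e^(-t) dt`. -/
def upperGamma (a z : ℝ) : ℝ := ∫ t in Ioi z, t ^ (a - 1) * Real.exp (-t)

/-- The gamma density formula `u^(x/b) e^(-u/b) / (b^(x/b+1) Γ(x/b+1))`, before restricting `u`. -/
def gammaProfile (x b u : ℝ) : ℝ :=
  u ^ (x / b) * Real.exp (-u / b) / (b ^ (x / b + 1) * Real.Gamma (x / b + 1))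

/-- Part of the gamma kernel on `0 ≤ u < c`. -/
def kernelL (x b c u : ℝ) : ℝ := (Ico 0 c).indicator (gammaProfile x b) u

/-- Part of the gamma kernel on `c ≤ u`. -/
def kernelU (x b c u : ℝ) : ℝ := (Ici c).indicator (gammaProfile x b) u

/-- Re-normalized lower truncated gamma kernel. -/
def kernelMinus (x b c u : ℝ) : ℝ :=
  Real.Gamma (x / b + 1) / lowerGamma (x / b + 1) (c / b) * kernelL x b c u

/-- Re-normalized upper truncated gamma kernel. -/
def kernelPlus (x b c u : ℝ) : ℝ :=
  Real.Gamma (x / b + 1) / upperGamma (x / b + 1) (c / b) * kernelU x b c u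

/-- Estimator of the left limit of the density at `c`, from the first `n` terms of `x`. -/
def fHatMinus (c : ℝ) (n : ℕ) (b : ℝ) (x : ℕ → ℝ) : ℝ :=
  1 / (n : ℝ) * ∑ i ∈ Finset.range n, kernelMinus c b c (x i)

/-- Estimator of the right limit of the density at `c`, from the first `n` terms of `x`. -/
def fHatPlus (c : ℝ) (n : ℕ) (b : ℝ) (x : ℕ → ℝ) : ℝ :=
  1 / (n : ℝ) * ∑ i ∈ Finset.range n, kernelPlus c b c (x i)

/-- The (untruncated) gamma kernel density estimator at `c`. -/
def fHat (c : ℝ) (n : ℕ) (b : ℝ) (x : ℕ → ℝ) : ℝ :=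
  1 / (n : ℝ) * ∑ i ∈ Finset.range n, (kernelL c b c (x i) + kernelU c b c (x i))

/-- Multiplicative bias correction: combines an estimate `p` with smoothing parameter `b` and an
estimate `q` with smoothing parameter `b / δ`. -/
def mbc (δ p q : ℝ) : ℝ := p ^ (1 / (1 - √δ)) * q ^ (-√δ / (1 - √δ))

/-- Bias-corrected estimator of the left limit of the density at `c`. -/
def fTildeMinus (δ c : ℝ) (n : ℕ) (b : ℝ) (x : ℕ → ℝ) : ℝ :=
  mbc δ (fHatMinus c n b x) (fHatMinus c n (b / δ) x)

/-- Bias-corrected estimator of the right limit of the density at `c`. -/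
def fTildePlus (δ c : ℝ) (n : ℕ) (b : ℝ) (x : ℕ → ℝ) : ℝ :=
  mbc δ (fHatPlus c n b x) (fHatPlus c n (b / δ) x)

/-- Bias-corrected estimator of the jump of the density at `c`. -/
def jTilde (δ c : ℝ) (n : ℕ) (b : ℝ) (x : ℕ → ℝ) : ℝ :=
  fTildePlus δ c n b x - fTildeMinus δ c n b x

/-- Jump `f₊(c) - f₋(c)` of the density at `c`. -/
def densityJump (f : ℝ → ℝ) (c : ℝ) : ℝ := Function.rightLim f c - Function.leftLim f c

/-- The variance factor `λ(δ)`. -/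
def varFactor (δ : ℝ) : ℝ :=
  ((1 + δ ^ (3 / 2 : ℝ)) * √(1 + δ) - 2 * √2 * δ) / (√(1 + δ) * (1 - √δ) ^ 2)

/-- The asymptotic variance `V(c)`. -/
def asympVar (δ : ℝ) (f : ℝ → ℝ) (c : ℝ) : ℝ :=
  varFactor δ * ((Function.rightLim f c + Function.leftLim f c) / (√Real.pi * √c))

/-- First variance estimator, `V(c)` with the bias-corrected one-sided estimators plugged in. -/
def vTilde₁ (δ c : ℝ) (n : ℕ) (b : ℝ) (x : ℕ → ℝ) : ℝ :=
  varFactor δ * ((fTildePlus δ c n b x + fTildeMinus δ c n b x) / (√Real.pi * √c))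

/-- Second variance estimator, based on the gamma kernel density estimator at `c`. -/
def vTilde₂ (δ c : ℝ) (n : ℕ) (b : ℝ) (x : ℕ → ℝ) : ℝ :=
  varFactor δ * (2 * fHat c n b x / (√Real.pi * √c))

/-- The test statistic, with `v` the value of the variance estimator. -/
def testStat (δ c : ℝ) (n : ℕ) (b : ℝ) (x : ℕ → ℝ) (v : ℝ) : ℝ :=
  √(n * √b) * jTilde δ c n b x / √v

/-- `X 0, X 1, …` are independent, each with probability density `f` supported on `[0, ∞)`. -/
structure IsRandomSample {Ω : Type*} [MeasurableSpace Ω] (P : Measure Ω) (X : ℕ → Ω → ℝ)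
    (f : ℝ → ℝ) : Prop where
  measurable_sample : ∀ i, Measurable (X i)
  indep : iIndepFun X P
  measurable_density : Measurable f
  nonneg : ∀ x, 0 ≤ f x
  support : ∀ x < 0, f x = 0
  law : ∀ i, P.map (X i) = volume.withDensity (fun x => ENNReal.ofReal (f x))

/-- Smoothness of the density away from `c`, existence of its one-sided limits at `c` (and of those
of its first two derivatives), and positivity of the former. -/
structure IsPiecewiseSmooth (f : ℝ → ℝ) (c : ℝ) : Prop where
  differentiable : ∀ x ∈ Ioo 0 c ∪ Ioi c, DifferentiableAt ℝ f x ∧ DifferentiableAt ℝ (deriv f) x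
  holder : ∃ ς L : ℝ≥0, 0 < ς ∧ ς ≤ 1 ∧
    HolderOnWith L ς (deriv (deriv f)) (Ioo 0 c) ∧ HolderOnWith L ς (deriv (deriv f)) (Ioi c)
  tendsto_left : Tendsto f (𝓝[<] c) (𝓝 (Function.leftLim f c))
  tendsto_right : Tendsto f (𝓝[>] c) (𝓝 (Function.rightLim f c))
  left_pos : 0 < Function.leftLim f c
  right_pos : 0 < Function.rightLim f c
  deriv_left : ∃ l, Tendsto (deriv f) (𝓝[<] c) (𝓝 l)
  deriv_right : ∃ l, Tendsto (deriv f) (𝓝[>] c) (𝓝 l)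
  deriv2_left : ∃ l, Tendsto (deriv (deriv f)) (𝓝[<] c) (𝓝 l)
  deriv2_right : ∃ l, Tendsto (deriv (deriv f)) (𝓝[>] c) (𝓝 l)

/-- `b_n > 0` and `b_n + (n b_n)⁻¹ → 0`. -/
structure IsSmoothingSeq (b : ℕ → ℝ) : Prop where
  pos : ∀ n, 0 < b n
  tendsto : Tendsto (fun n : ℕ => b n + ((n : ℝ) * b n)⁻¹) atTop (𝓝 0)

end

/-! Divided by `n^(1/2) b^(1/4)`, the statistic `|T(c)|` tends in probability to `|J(c)| / √V(c)`,
which is positive, while `B_n` divided by the same rate tends to `0`. So consistency of the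
numerator and of the variance estimator is enough; no limit law or bias expansion enters. This last
step is `tendsto_measure_lt_abs_testStat`, with `varFactor_pos` making the limit variance positive.

For the one-sided estimators, put `a = c/b → ∞` and `u = c v`. The gamma kernel at the design point
`c` has its mode at `c`, so after rescaling each truncated kernel is `gammaPeak a` on one side of
`1`, normalized by its integral there (`kernelMinus_eq`, `kernelPlus_eq`). Laplace's method
(`tendsto_sqrt_mul_setIntegral_gammaPeak`) shows that this integral is of exact order `a^(-1/2)`,
and `gammaPeak` decays exponentially in `a` away from `1`. Hence the normalized kernels are
approximate identities and the means converge to the one-sided limits of `f`. The variance is at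
most (sup of the kernel / `n`) times the mean, so Chebyshev's inequality finishes
(`tendstoInProb_mean`).

Bias correction preserves a common positive limit because its exponents sum to `1`. The untruncated
estimator is a mixture of the two one-sided ones with weights tending to `1/2`, which handles the
second variance estimator. -/

/-! ### Pointwise bounds on the rescaled gamma density -/

/-- The gamma density with mode `1` and shape `a + 1`, scaled to have maximum `1`. -/
noncomputable def gammaPeak (a v : ℝ) : ℝ := v ^ a * Real.exp (a - a * v)

/-- The rate at which `gammaPeak` decays away from its mode. -/
noncomputable def peakRate (x : ℝ) : ℝ := x ^ 2 / (2 * (1 + |x|))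

/-- For `x ≥ 0`, apply `log y ≤ sinh (log y) = (y - 1/y) / 2` at `y = 1 + x`; the right side is
exactly `x - x² / (2(1 + x))`. For `x ≤ 0`, all terms of the series of `-log (1 + x)` in powers of
`-x` are nonnegative, and two of them suffice. -/
theorem log_one_add_le_sub_peakRate {x : ℝ} (hx : -1 < x) :
    Real.log (1 + x) ≤ x - peakRate x := by
  unfold peakRate
  have hx1 : 0 < 1 + x := by linarith
  rcases le_total 0 x with h | h
  · have h1 : Real.log (1 + x) ≤ Real.sinh (Real.log (1 + x)) :=
      Real.self_le_sinh_iff.2 (Real.log_nonneg (by linarith))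
    rw [Real.sinh_log hx1] at h1
    rw [abs_of_nonneg h]
    refine h1.trans (le_of_eq ?_)
    field_simp
    ring
  · have h1 : |-x| < 1 := by rw [abs_neg, abs_of_nonpos h]; linarith
    have h2 := Real.hasSum_pow_div_log_of_abs_lt_one h1
    have h3 := sum_le_hasSum (Finset.range 2) (fun i _ => by
      have : 0 ≤ -x := by linarith
      positivity) h2
    simp only [Finset.sum_range_succ, Finset.sum_range_zero] at h3
    norm_num at h3
    have h4 : x ^ 2 / (2 * (1 + |x|)) ≤ x ^ 2 / 2 := by
      apply div_le_div_of_nonneg_left (sq_nonneg x) (by norm_num)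
      linarith [abs_nonneg x]
    linarith

theorem peakRate_nonneg (x : ℝ) : 0 ≤ peakRate x := by unfold peakRate; positivity

theorem peakRate_mono {x y : ℝ} (hx : 0 ≤ x) (hxy : x ≤ |y|) : peakRate x ≤ peakRate y := by
  unfold peakRate
  rw [abs_of_nonneg hx, ← sq_abs y, div_le_div_iff₀ (by positivity) (by positivity)]
  nlinarith [mul_nonneg hx (abs_nonneg y), mul_nonneg (mul_nonneg hx (abs_nonneg y)) (sub_nonneg.2 hxy),
    mul_nonneg (sub_nonneg.2 hxy) (add_nonneg hx (abs_nonneg y))]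

theorem peakRate_pos {x : ℝ} (hx : 0 < x) : 0 < peakRate x := by unfold peakRate; positivity

theorem gammaPeak_eq_exp {a v : ℝ} (hv : 0 < v) :
    gammaPeak a v = Real.exp (a * (Real.log v - (v - 1))) := by
  rw [gammaPeak, Real.rpow_def_of_pos hv, ← Real.exp_add]
  ring_nf

theorem gammaPeak_nonneg {a v : ℝ} (hv : 0 ≤ v) : 0 ≤ gammaPeak a v := by
  unfold gammaPeak; positivity

theorem gammaPeak_le {a v : ℝ} (ha : 0 ≤ a) (hv : 0 < v) :
    gammaPeak a v ≤ Real.exp (-(a * peakRate (v - 1))) := by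
  rw [gammaPeak_eq_exp hv, Real.exp_le_exp]
  have := log_one_add_le_sub_peakRate (x := v - 1) (by linarith)
  rw [add_sub_cancel] at this
  nlinarith

theorem gammaPeak_le_one {a v : ℝ} (ha : 0 < a) (hv : 0 ≤ v) : gammaPeak a v ≤ 1 := by
  rcases hv.eq_or_lt with rfl | hv
  · simp [gammaPeak, Real.zero_rpow ha.ne']
  · refine (gammaPeak_le ha.le hv).trans ?_
    rw [Real.exp_le_one_iff]
    have := mul_nonneg ha.le (peakRate_nonneg (v - 1))
    linarith

@[fun_prop]
theorem measurable_gammaPeak (a : ℝ) : Measurable (gammaPeak a) := by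
  unfold gammaPeak; fun_prop

/-! ### Laplace asymptotics -/

/-- Second-order Taylor expansion at `x = s/√a`: the remainder is at most `|x|³ / (1 - |x|)`, and `a
|x|³ = s² |x| → 0`. This yields the Gaussian exponent. -/
theorem tendsto_mul_log_one_add_div_sqrt (s : ℝ) :
    Tendsto (fun a : ℝ => a * (Real.log (1 + s / √a) - s / √a)) atTop (𝓝 (-s ^ 2 / 2)) := by
  have hsq : Tendsto (fun a : ℝ => √a) atTop atTop := Real.tendsto_sqrt_atTop
  have h0 : Tendsto (fun a : ℝ => s / √a) atTop (𝓝 0) := hsq.const_div_atTop s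
  rw [tendsto_iff_norm_sub_tendsto_zero]
  have hb : Tendsto (fun a : ℝ => |s| ^ 2 * |s / √a| / (1 - |s / √a|)) atTop (𝓝 0) := by
    have h1 : Tendsto (fun a : ℝ => |s / √a|) atTop (𝓝 0) := by simpa using h0.abs
    have := (h1.const_mul (|s| ^ 2)).div (h1.const_sub 1) (by norm_num)
    rw [mul_zero, zero_div] at this
    exact this
  refine squeeze_zero' (Eventually.of_forall fun _ => norm_nonneg _) ?_ hb
  have h1 : ∀ᶠ a : ℝ in atTop, |s / √a| < 1 := by
    have h1 : Tendsto (fun a : ℝ => |s / √a|) atTop (𝓝 0) := by simpa using h0.abs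
    exact h1.eventually_lt_const (by norm_num)
  filter_upwards [h1, eventually_gt_atTop 0] with a ha ha0
  have h2 := Real.abs_log_sub_add_sum_range_le (x := -(s / √a)) (by rwa [abs_neg]) 2
  simp only [Finset.sum_range_succ, Finset.sum_range_zero, abs_neg, sub_neg_eq_add] at h2
  have hs2 : √a ^ 2 = a := Real.sq_sqrt ha0.le
  have hs0 : 0 < √a := Real.sqrt_pos.2 ha0
  have e1 : a * (Real.log (1 + s / √a) - s / √a) - -s ^ 2 / 2 =
      a * ((0 + (-(s / √a)) ^ (0 + 1) / (((0 : ℕ) : ℝ) + 1) +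
        (-(s / √a)) ^ (1 + 1) / (((1 : ℕ) : ℝ) + 1)) + Real.log (1 + s / √a)) := by
    have : a * (s / √a) ^ 2 = s ^ 2 := by rw [div_pow, hs2]; field_simp
    push_cast
    linear_combination (-1 / 2 : ℝ) * this
  rw [e1, Real.norm_eq_abs, abs_mul, abs_of_pos ha0]
  refine (mul_le_mul_of_nonneg_left h2 ha0.le).trans (le_of_eq ?_)
  have : a * |s / √a| ^ (2 + 1) = |s| ^ 2 * |s / √a| := by
    rw [pow_succ, abs_div, abs_of_pos hs0, div_pow, hs2]; field_simp
  rw [← mul_div_assoc, this]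

theorem integrable_exp_half_sub_abs : Integrable fun s : ℝ => Real.exp ((1 - |s|) / 2) := by
  refine (integrable_inv_one_add_sq.const_mul (8 * Real.exp (1 / 2))).mono'
    (by fun_prop) (Eventually.of_forall fun s => ?_)
  -- At `|s|/2` the quadratic term is `s²/8`, whence the constant `8` above.
  have h := Real.quadratic_le_exp_of_nonneg (x := |s| / 2) (by positivity)
  rw [Real.norm_of_nonneg (Real.exp_pos _).le, sub_div, Real.exp_sub, div_le_iff₀ (Real.exp_pos _)]
  have h2 : 1 ≤ 8 * (1 + s ^ 2)⁻¹ * Real.exp (|s| / 2) := by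
    rw [mul_assoc, mul_comm _ (Real.exp _), ← mul_assoc, ← div_eq_mul_inv,
      le_div_iff₀ (by positivity)]
    nlinarith [sq_abs s, abs_nonneg s]
  nlinarith [Real.exp_pos (1 / 2 : ℝ)]

/-- The left side equals `s² / (2(1 + |s|/√a))` after multiplying out, increasing in `a`, so `a = 1`
is the worst case. Being free of `a`, the bound supplies the dominating function in Laplace's
method. -/
theorem peakRate_div_sqrt_ge {a : ℝ} (ha : 1 ≤ a) (s : ℝ) :
    (|s| - 1) / 2 ≤ a * peakRate (s / √a) := by
  have h1 : 1 ≤ √a := Real.one_le_sqrt.2 ha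
  have hs2 : √a ^ 2 = a := Real.sq_sqrt (by linarith)
  have e : a * peakRate (s / √a) = s ^ 2 / (2 * (1 + |s| / √a)) := by
    rw [peakRate, abs_div, abs_of_pos (by linarith : 0 < √a), div_pow, hs2]
    field_simp
  rw [e, div_le_div_iff₀ (by norm_num) (by positivity)]
  have h2 : |s| / √a ≤ |s| := div_le_self (abs_nonneg s) h1
  have h3 : 0 ≤ |s| / √a := by positivity
  rcases le_total |s| 1 with h | h
  · nlinarith [sq_nonneg s]
  · nlinarith [sq_abs s]

/-- Laplace's method for `gammaPeak`: after rescaling by `√a` around the mode it becomes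
Gaussian. -/
theorem tendsto_sqrt_mul_setIntegral_gammaPeak {S T : Set ℝ} (hS : MeasurableSet S)
    (hS0 : S ⊆ Ioi 0) (hT : MeasurableSet T)
    (hST : ∀ s : ℝ, s ≠ 0 → ∀ᶠ a : ℝ in atTop, (1 + s / √a ∈ S ↔ s ∈ T)) :
    Tendsto (fun a => √a * ∫ v in S, gammaPeak a v) atTop
      (𝓝 (∫ s in T, Real.exp (-(1 / 2) * s ^ 2))) := by
  have hEq : ∀ᶠ a : ℝ in atTop,
      ∫ s, S.indicator (gammaPeak a) (1 + s / √a) = √a * ∫ v in S, gammaPeak a v := by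
    filter_upwards with a
    rw [Measure.integral_comp_div (fun s => S.indicator (gammaPeak a) (1 + s)),
      integral_add_left_eq_self, integral_indicator hS, abs_of_nonneg (Real.sqrt_nonneg a),
      smul_eq_mul]
  rw [← integral_indicator hT]
  refine Tendsto.congr' hEq (tendsto_integral_filter_of_dominated_convergence
    (fun s => Real.exp ((1 - |s|) / 2)) ?_ ?_ integrable_exp_half_sub_abs ?_)
  · refine Eventually.of_forall fun a => Measurable.aestronglyMeasurable ?_
    exact ((measurable_gammaPeak a).indicator hS).comp (by fun_prop)
  · filter_upwards [eventually_ge_atTop 1] with a ha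
    refine Eventually.of_forall fun s => ?_
    by_cases h : 1 + s / √a ∈ S
    · rw [indicator_of_mem h, Real.norm_of_nonneg (gammaPeak_nonneg (hS0 h).le)]
      refine (gammaPeak_le (by linarith) (hS0 h)).trans (Real.exp_le_exp.2 ?_)
      have := peakRate_div_sqrt_ge ha s
      rw [add_sub_cancel_left]
      linarith
    · rw [indicator_of_notMem h, norm_zero]
      exact (Real.exp_pos _).le
  · have : ∀ᵐ s : ℝ, s ≠ 0 := by simp [ae_iff]
    filter_upwards [this] with s hs
    by_cases hsT : s ∈ T
    · rw [indicator_of_mem hsT]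
      have h1 := (Real.continuous_exp.tendsto _).comp (tendsto_mul_log_one_add_div_sqrt s)
      have e : -(1 / 2) * s ^ 2 = -s ^ 2 / 2 := by ring
      rw [e]
      refine h1.congr' ?_
      filter_upwards [hST s hs] with a ha
      have hm := ha.2 hsT
      rw [indicator_of_mem hm, gammaPeak_eq_exp (hS0 hm), add_sub_cancel_left]
      rfl
    · rw [indicator_of_notMem hsT]
      refine tendsto_const_nhds.congr' ?_
      filter_upwards [hST s hs] with a ha
      rw [indicator_of_notMem (mt ha.1 hsT)]

theorem eventually_one_add_div_sqrt_mem_Ioo (s : ℝ) :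
    ∀ᶠ a : ℝ in atTop, 0 < √a ∧ 1 + s / √a ∈ Ioo (0 : ℝ) 2 := by
  have h0 : Tendsto (fun a : ℝ => 1 + s / √a) atTop (𝓝 1) := by
    simpa using (Real.tendsto_sqrt_atTop.const_div_atTop s).const_add 1
  filter_upwards [h0.eventually (Ioo_mem_nhds zero_lt_one one_lt_two),
    eventually_gt_atTop 0] with a h1 h2
  exact ⟨Real.sqrt_pos.2 h2, h1⟩

theorem integral_Iio_gaussian_half :
    ∫ s in Iio (0 : ℝ), Real.exp (-(1 / 2) * s ^ 2) = √(Real.pi / (1 / 2)) / 2 := by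
  rw [← integral_Iic_eq_integral_Iio, ← integral_gaussian_Ioi]
  have := integral_comp_neg_Ioi 0 (fun s : ℝ => Real.exp (-(1 / 2) * s ^ 2))
  simpa using this.symm

theorem tendsto_sqrt_mul_integral_gammaPeak_Ioo :
    Tendsto (fun a => √a * ∫ v in Ioo 0 1, gammaPeak a v) atTop
      (𝓝 (√(Real.pi / (1 / 2)) / 2)) := by
  rw [← integral_Iio_gaussian_half]
  refine tendsto_sqrt_mul_setIntegral_gammaPeak measurableSet_Ioo (fun x hx => hx.1)
    measurableSet_Iio fun s _ => ?_
  filter_upwards [eventually_one_add_div_sqrt_mem_Ioo s] with a ⟨h1, h2, h3⟩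
  simp only [mem_Ioo, h2, true_and, mem_Iio]
  rw [add_lt_iff_neg_left, div_lt_iff₀ h1, zero_mul]

theorem tendsto_sqrt_mul_integral_gammaPeak_Ioi :
    Tendsto (fun a => √a * ∫ v in Ioi 1, gammaPeak a v) atTop
      (𝓝 (√(Real.pi / (1 / 2)) / 2)) := by
  rw [← integral_gaussian_Ioi]
  refine tendsto_sqrt_mul_setIntegral_gammaPeak measurableSet_Ioi
    (fun x hx => mem_Ioi.2 (zero_lt_one.trans hx)) measurableSet_Ioi fun s _ => ?_
  filter_upwards [eventually_one_add_div_sqrt_mem_Ioo s] with a ⟨h1, h2, h3⟩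
  rw [mem_Ioi, mem_Ioi, lt_add_iff_pos_right, div_pos_iff_of_pos_right h1]

/-- The peak-function theorem wants a set of finite measure carrying asymptotically all the mass; on
the upper side `Ioc 1 2` plays that role, having the same limit as `Ioi 1`. -/
theorem tendsto_sqrt_mul_integral_gammaPeak_Ioc :
    Tendsto (fun a => √a * ∫ v in Ioc 1 2, gammaPeak a v) atTop
      (𝓝 (√(Real.pi / (1 / 2)) / 2)) := by
  rw [← integral_gaussian_Ioi]
  refine tendsto_sqrt_mul_setIntegral_gammaPeak measurableSet_Ioc
    (fun x hx => mem_Ioi.2 (zero_lt_one.trans hx.1)) measurableSet_Ioi fun s _ => ?_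
  filter_upwards [eventually_one_add_div_sqrt_mem_Ioo s] with a ⟨h1, h2, h3⟩
  rw [mem_Ioc, mem_Ioi, lt_add_iff_pos_right, div_pos_iff_of_pos_right h1]
  exact and_iff_left h3.le

theorem tendsto_sqrt_mul_exp_neg {κ : ℝ} (hκ : 0 < κ) :
    Tendsto (fun a : ℝ => √a * Real.exp (-(a * κ))) atTop (𝓝 0) := by
  refine (tendsto_rpow_mul_exp_neg_mul_atTop_nhds_zero (1 / 2) κ hκ).congr fun a => ?_
  rw [Real.sqrt_eq_rpow]
  ring_nf

/-! ### Approximate identities at the mode -/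

/-- The normalized `gammaPeak` on `S` is an approximate identity at `1`. -/
theorem tendsto_setIntegral_gammaPeak_div_mul {S t : Set ℝ} {ℓ y : ℝ} {g : ℝ → ℝ}
    (hS : MeasurableSet S) (hS0 : S ⊆ Ioi 0) (ht : MeasurableSet t) (htS : t ⊆ S)
    (ht1 : t ∈ 𝓝[S] 1) (htf : volume t ≠ ⊤) (hℓ : 0 < ℓ)
    (hIS : Tendsto (fun a => √a * ∫ v in S, gammaPeak a v) atTop (𝓝 ℓ))
    (hIt : Tendsto (fun a => √a * ∫ v in t, gammaPeak a v) atTop (𝓝 ℓ))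
    (hg : IntegrableOn g S) (hgy : Tendsto g (𝓝[S] 1) (𝓝 y)) :
    Tendsto (fun a => ∫ v in S, gammaPeak a v / (∫ w in S, gammaPeak a w) * g v) atTop (𝓝 y) := by
  refine tendsto_setIntegral_peak_smul_of_integrableOn_of_tendsto
    (φ := fun a v => gammaPeak a v / (∫ w in S, gammaPeak a w)) hS ht htS ht1 htf ?_ ?_ ?_ ?_ hg hgy
  · refine Eventually.of_forall fun a x hx => div_nonneg (gammaPeak_nonneg (hS0 hx).le) ?_
    exact setIntegral_nonneg hS fun v hv => gammaPeak_nonneg (hS0 hv).le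
  · intro u hu h1u
    obtain ⟨η, hη, hηu⟩ := Metric.isOpen_iff.1 hu 1 h1u
    rw [Metric.tendstoUniformlyOn_iff]
    intro ε hε
    -- At distance `η` or more from `1` the peak is exponentially small in `a`, whereas the
    -- normalizing integral decays only like `a^(-1/2)`.
    have hlim : Tendsto (fun a : ℝ => √a * Real.exp (-(a * peakRate η)) /
        (√a * ∫ v in S, gammaPeak a v)) atTop (𝓝 0) := by
      have h := (tendsto_sqrt_mul_exp_neg (peakRate_pos hη)).div hIS hℓ.ne'
      rwa [zero_div] at h
    filter_upwards [hlim.eventually_lt_const hε, eventually_gt_atTop 0,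
      hIS.eventually_const_lt hℓ] with a ha ha0 haI v hv
    have hsa : 0 < √a := Real.sqrt_pos.2 ha0
    have hI : 0 < ∫ v in S, gammaPeak a v := (mul_pos_iff_of_pos_left hsa).1 haI
    rw [mul_div_mul_left _ _ hsa.ne'] at ha
    have hv1 : η ≤ |v - 1| := by
      by_contra! h
      exact hv.2 (hηu (by rwa [Metric.mem_ball, Real.dist_eq]))
    rw [Pi.zero_apply, dist_zero_left, Real.norm_of_nonneg
      (div_nonneg (gammaPeak_nonneg (hS0 hv.1).le) hI.le)]
    refine lt_of_le_of_lt (div_le_div_of_nonneg_right ?_ hI.le) ha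
    refine (gammaPeak_le ha0.le (hS0 hv.1)).trans (Real.exp_le_exp.2 ?_)
    have := mul_le_mul_of_nonneg_left (peakRate_mono hη.le hv1) ha0.le
    linarith
  · have h := hIt.div hIS hℓ.ne'
    rw [div_self hℓ.ne'] at h
    refine h.congr' ?_
    filter_upwards [eventually_gt_atTop 0] with a ha0
    have hsa : 0 < √a := Real.sqrt_pos.2 ha0
    simp only [Pi.div_apply]
    rw [mul_div_mul_left _ _ hsa.ne', integral_div]
  · exact Eventually.of_forall fun a =>
      ((measurable_gammaPeak a).div_const _).aestronglyMeasurable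

/-! ### Incomplete gamma functions and kernels in terms of the rescaled density -/

/-- Substitute `t = a v` and factor out the maximum `a^a e^(-a)` of the integrand, attained at `v =
1`. -/
theorem setIntegral_rpow_mul_exp_neg {a : ℝ} (ha : 0 < a) {S S' : Set ℝ} (hS : MeasurableSet S)
    (hS' : MeasurableSet S') (hS0 : S ⊆ Ioi 0) (h : ∀ v, a * v ∈ S' ↔ v ∈ S) :
    ∫ t in S', t ^ (a + 1 - 1) * Real.exp (-t) =
      a ^ (a + 1) * Real.exp (-a) * ∫ v in S, gammaPeak a v := by
  have h1 := Measure.integral_comp_mul_left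
    (S'.indicator fun t => t ^ (a + 1 - 1) * Real.exp (-t)) a
  rw [integral_indicator hS', abs_of_pos (inv_pos.2 ha), smul_eq_mul] at h1
  have h2 : (fun v => (S'.indicator fun t => t ^ (a + 1 - 1) * Real.exp (-t)) (a * v)) =
      S.indicator fun v => a ^ a * Real.exp (-a) * gammaPeak a v := by
    ext v
    by_cases hv : v ∈ S
    · have hv0 : 0 < v := hS0 hv
      rw [indicator_of_mem hv, indicator_of_mem ((h v).2 hv), gammaPeak, add_sub_cancel_right,
        Real.mul_rpow ha.le hv0.le, show -(a * v) = -a + (a - a * v) by ring, Real.exp_add]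
      ring
    · rw [indicator_of_notMem hv, indicator_of_notMem (mt (h v).1 hv)]
  rw [h2, integral_indicator hS, integral_const_mul] at h1
  rw [Real.rpow_add_one ha.ne']
  field_simp at h1
  linear_combination -h1

theorem lowerGamma_eq {a : ℝ} (ha : 0 < a) :
    lowerGamma (a + 1) a = a ^ (a + 1) * Real.exp (-a) * ∫ v in Ioo 0 1, gammaPeak a v := by
  rw [lowerGamma, integral_Ioc_eq_integral_Ioo]
  refine setIntegral_rpow_mul_exp_neg ha measurableSet_Ioo measurableSet_Ioo (fun x hx => hx.1)
    fun v => ?_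
  rw [mem_Ioo, mem_Ioo, mul_pos_iff_of_pos_left ha, mul_lt_iff_lt_one_right ha]

theorem upperGamma_eq {a : ℝ} (ha : 0 < a) :
    upperGamma (a + 1) a = a ^ (a + 1) * Real.exp (-a) * ∫ v in Ioi 1, gammaPeak a v := by
  refine setIntegral_rpow_mul_exp_neg ha measurableSet_Ioi measurableSet_Ioi
    (fun x hx => mem_Ioi.2 (zero_lt_one.trans hx)) fun v => ?_
  rw [mem_Ioi, mem_Ioi, lt_mul_iff_one_lt_right ha]

theorem lowerGamma_add_upperGamma {a z : ℝ} (ha : 0 < a) (hz : 0 ≤ z) :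
    lowerGamma a z + upperGamma a z = Real.Gamma a := by
  have h := Real.GammaIntegral_convergent ha
  simp_rw [mul_comm (Real.exp _)] at h
  rw [lowerGamma, upperGamma, Real.Gamma_eq_integral ha, ← setIntegral_union
    (Ioc_disjoint_Ioi le_rfl) measurableSet_Ioi (h.mono_set Ioc_subset_Ioi_self)
    (h.mono_set (Ioi_subset_Ioi hz)), Ioc_union_Ioi_eq_Ioi hz]
  simp_rw [mul_comm (Real.exp _)]

theorem gammaProfile_eq {b c u : ℝ} (hb : 0 < b) (hc : 0 < c) (hu : 0 ≤ u) :
    gammaProfile c b u = (c / b) ^ (c / b) * Real.exp (-(c / b)) * gammaPeak (c / b) (u / c) /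
      (b * Real.Gamma (c / b + 1)) := by
  have ha : 0 < c / b := div_pos hc hb
  have e1 : u ^ (c / b) = (c / b) ^ (c / b) * b ^ (c / b) * (u / c) ^ (c / b) := by
    rw [← Real.mul_rpow ha.le hb.le, ← Real.mul_rpow (by positivity) (by positivity)]
    congr 1
    field_simp
  have e2 : Real.exp (-u / b) = Real.exp (-(c / b)) * Real.exp (c / b - c / b * (u / c)) := by
    rw [← Real.exp_add]
    congr 1
    field_simp
    ring
  have hG := (Real.Gamma_pos_of_pos (by linarith : 0 < c / b + 1)).ne'
  have hbp := (Real.rpow_pos_of_pos hb (c / b)).ne'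
  rw [gammaProfile, gammaPeak, e1, e2, Real.rpow_add_one hb.ne']
  field_simp

/-- The factor `a^a e^(-a)` and the complete gamma function cancel between kernel and normalization,
with `a = c/b`; the remaining `a b` is the `c` in the denominator. -/
theorem kernelMinus_eq {b c : ℝ} (hb : 0 < b) (hc : 0 < c) :
    kernelMinus c b c = (Ico 0 c).indicator fun u =>
      gammaPeak (c / b) (u / c) / (c * ∫ v in Ioo 0 1, gammaPeak (c / b) v) := by
  have ha : 0 < c / b := div_pos hc hb
  ext u
  rw [kernelMinus, kernelL]
  by_cases hu : u ∈ Ico 0 c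
  · rw [indicator_of_mem hu, indicator_of_mem hu, gammaProfile_eq hb hc hu.1, lowerGamma_eq ha,
      Real.rpow_add_one ha.ne']
    have hG := (Real.Gamma_pos_of_pos (by linarith : 0 < c / b + 1)).ne'
    have hap := (Real.rpow_pos_of_pos ha (c / b)).ne'
    generalize ∫ v in Ioo 0 1, gammaPeak (c / b) v = I
    generalize (c / b) ^ (c / b) = p at *
    field_simp
  · rw [indicator_of_notMem hu, indicator_of_notMem hu, mul_zero]

theorem kernelPlus_eq {b c : ℝ} (hb : 0 < b) (hc : 0 < c) :
    kernelPlus c b c = (Ici c).indicator fun u =>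
      gammaPeak (c / b) (u / c) / (c * ∫ v in Ioi 1, gammaPeak (c / b) v) := by
  have ha : 0 < c / b := div_pos hc hb
  ext u
  rw [kernelPlus, kernelU]
  by_cases hu : u ∈ Ici c
  · rw [indicator_of_mem hu, indicator_of_mem hu, gammaProfile_eq hb hc (hc.le.trans hu),
      upperGamma_eq ha, Real.rpow_add_one ha.ne']
    have hG := (Real.Gamma_pos_of_pos (by linarith : 0 < c / b + 1)).ne'
    have hap := (Real.rpow_pos_of_pos ha (c / b)).ne'
    generalize ∫ v in Ioi 1, gammaPeak (c / b) v = I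
    generalize (c / b) ^ (c / b) = p at *
    field_simp
  · rw [indicator_of_notMem hu, indicator_of_notMem hu, mul_zero]

/-! ### Convergence in probability to a constant -/

/-- Convergence in probability to a constant, in terms of neighbourhoods of the limit. -/
def TendstoInProb {Ω E : Type*} [MeasurableSpace Ω] [TopologicalSpace E] (P : Measure Ω)
    (U : ℕ → Ω → E) (x : E) : Prop :=
  ∀ N ∈ 𝓝 x, Tendsto (fun n => P {ω | U n ω ∉ N}) atTop (𝓝 0)

namespace TendstoInProb

variable {Ω E F : Type*} [MeasurableSpace Ω] [TopologicalSpace E] [TopologicalSpace F]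
  {P : Measure Ω} {U W : ℕ → Ω → E} {x : E}

theorem prodMk {V : ℕ → Ω → F} {y : F} (hU : TendstoInProb P U x) (hV : TendstoInProb P V y) :
    TendstoInProb P (fun n ω => (U n ω, V n ω)) (x, y) := by
  intro N hN
  obtain ⟨A, hA, B, hB, hAB⟩ := mem_nhds_prod_iff.1 hN
  have h := (hU A hA).add (hV B hB)
  rw [add_zero] at h
  refine tendsto_of_tendsto_of_tendsto_of_le_of_le tendsto_const_nhds h (fun _ => zero_le)
    fun n => (measure_mono fun ω hω => ?_).trans (measure_union_le _ _)
  by_contra hcon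
  simp only [mem_union, mem_ofPred_eq, not_or, not_not] at hcon
  exact hω (hAB ⟨hcon.1, hcon.2⟩)

/-- The neighbourhood formulation makes continuous mapping a matter of preimages. Continuity at the
limit alone suffices, as needed for real powers, quotients and square roots. -/
theorem map {g : E → F} (hU : TendstoInProb P U x) (hg : ContinuousAt g x) :
    TendstoInProb P (fun n ω => g (U n ω)) (g x) :=
  fun N hN => hU (g ⁻¹' N) (hg hN)

theorem congr' (hU : TendstoInProb P U x) (h : ∀ᶠ n in atTop, U n = W n) :
    TendstoInProb P W x := by
  intro N hN
  refine (hU N hN).congr' ?_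
  filter_upwards [h] with n hn
  rw [hn]

theorem const {u : ℕ → E} (hu : Tendsto u atTop (𝓝 x)) :
    TendstoInProb P (fun n _ => u n) x := by
  intro N hN
  refine tendsto_const_nhds.congr' ?_
  filter_upwards [hu hN] with n hn
  simp [show u n ∈ N from hn]

/-- Only subadditivity is used, so no measurability of the events `A n` is required. -/
theorem measure_tendsto_one [IsProbabilityMeasure P] (hU : TendstoInProb P U x) {N : Set E}
    (hN : N ∈ 𝓝 x) {A : ℕ → Set Ω} (hA : ∀ᶠ n in atTop, ∀ ω, U n ω ∈ N → ω ∈ A n) :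
    Tendsto (fun n => P (A n)) atTop (𝓝 1) := by
  have h : Tendsto (fun n => 1 - P {ω | U n ω ∉ N}) atTop (𝓝 (1 - 0)) :=
    ENNReal.Tendsto.sub tendsto_const_nhds (hU N hN) (Or.inl ENNReal.one_ne_top)
  rw [tsub_zero] at h
  refine tendsto_of_tendsto_of_tendsto_of_le_of_le' h tendsto_const_nhds ?_
    (Eventually.of_forall fun n => prob_le_one)
  filter_upwards [hA] with n hn
  rw [tsub_le_iff_right, ← measure_univ (μ := P)]
  refine (measure_mono fun ω _ => ?_).trans (measure_union_le _ _)
  by_cases h : U n ω ∈ N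
  · exact Or.inl (hn ω h)
  · exact Or.inr h

theorem of_abs {U : ℕ → Ω → ℝ} {x : ℝ}
    (h : ∀ ε > 0, Tendsto (fun n => P {ω | ε ≤ |U n ω - x|}) atTop (𝓝 0)) :
    TendstoInProb P U x := by
  intro N hN
  obtain ⟨ε, hε, hεN⟩ := Metric.mem_nhds_iff.1 hN
  refine tendsto_of_tendsto_of_tendsto_of_le_of_le tendsto_const_nhds (h ε hε) (fun _ => zero_le)
    fun n => measure_mono fun ω hω => ?_
  by_contra hcon
  exact hω (hεN (by rw [Metric.mem_ball, Real.dist_eq]; exact not_le.1 hcon))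

theorem of_tendstoInMeasure {U : ℕ → Ω → ℝ} {x : ℝ}
    (h : TendstoInMeasure P U atTop fun _ => x) : TendstoInProb P U x :=
  of_abs fun ε hε => by
    simpa only [Real.dist_eq] using tendstoInMeasure_iff_dist.1 h ε hε

end TendstoInProb

/-! ### Moments of the sample and a weak law -/

namespace IsRandomSample

variable {Ω : Type*} [MeasurableSpace Ω] {P : Measure Ω} {X : ℕ → Ω → ℝ} {f : ℝ → ℝ}

theorem integrable_density [IsProbabilityMeasure P] (hX : IsRandomSample P X f) : Integrable f := by
  refine ⟨hX.measurable_density.aestronglyMeasurable, ?_⟩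
  rw [hasFiniteIntegral_iff_ofReal (Eventually.of_forall hX.nonneg)]
  have h := hX.law 0
  have : IsProbabilityMeasure (P.map (X 0)) :=
    Measure.isProbabilityMeasure_map (hX.measurable_sample 0).aemeasurable
  rw [h] at this
  have h1 := this.measure_univ
  rw [withDensity_apply _ MeasurableSet.univ, setLIntegral_univ] at h1
  rw [h1]
  exact ENNReal.one_lt_top

theorem integral_comp (hX : IsRandomSample P X f) {g : ℝ → ℝ} (hg : Measurable g) (i : ℕ) :
    ∫ ω, g (X i ω) ∂P = ∫ u, g u * f u := by
  rw [← integral_map (hX.measurable_sample i).aemeasurable hg.aestronglyMeasurable, hX.law i,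
    integral_withDensity_eq_integral_toReal_smul hX.measurable_density.ennreal_ofReal
      (Eventually.of_forall fun _ => ENNReal.ofReal_lt_top)]
  refine integral_congr_ae (Eventually.of_forall fun u => ?_)
  simp only [ENNReal.toReal_ofReal (hX.nonneg u), smul_eq_mul]
  ring

/-- Weak law of large numbers for averages of nonnegative kernels of size `o(n)`. -/
theorem tendstoInProb_mean [IsProbabilityMeasure P] (hX : IsRandomSample P X f) {K : ℕ → ℝ → ℝ} {M : ℕ → ℝ} {y : ℝ}
    (hK : ∀ n, Measurable (K n)) (hKM : ∀ᶠ n in atTop, ∀ u, 0 ≤ K n u ∧ K n u ≤ M n)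
    (hM : Tendsto (fun n => M n / (n : ℝ)) atTop (𝓝 0))
    (hy : Tendsto (fun n => ∫ u, K n u * f u) atTop (𝓝 y)) :
    TendstoInProb P (fun n ω => 1 / (n : ℝ) * ∑ i ∈ Finset.range n, K n (X i ω)) y := by
  refine TendstoInProb.of_abs fun ε hε => ?_
  have hlim : Tendsto (fun n : ℕ => ENNReal.ofReal
      ((M n / n * ∫ u, K n u * f u) / (ε / 2) ^ 2)) atTop (𝓝 0) := by
    have h := ENNReal.tendsto_ofReal ((hM.mul hy).div_const ((ε / 2) ^ 2))
    rwa [zero_mul, zero_div, ENNReal.ofReal_zero] at h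
  refine tendsto_of_tendsto_of_tendsto_of_le_of_le' tendsto_const_nhds hlim
    (Eventually.of_forall fun _ => zero_le) ?_
  have hy2 := Metric.tendsto_nhds.1 hy (ε / 2) (by positivity)
  filter_upwards [hKM, hy2, eventually_gt_atTop 0] with n hn hyn hn0
  have hn' : (0 : ℝ) < n := by exact_mod_cast hn0
  set e := ∫ u, K n u * f u with he
  have hmeas : ∀ i, Measurable fun ω => K n (X i ω) := fun i =>
    (hK n).comp (hX.measurable_sample i)
  have hbd : ∀ i, ∀ᵐ ω ∂P, ‖K n (X i ω)‖ ≤ M n := fun i => Eventually.of_forall fun ω => by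
    rw [Real.norm_of_nonneg (hn _).1]; exact (hn _).2
  have hL2 : ∀ i, MemLp (fun ω => K n (X i ω)) 2 P := fun i =>
    MemLp.of_bound (hmeas i).aestronglyMeasurable (M n) (hbd i)
  have hint : ∀ i, Integrable (fun ω => K n (X i ω)) P := fun i =>
    (hL2 i).integrable (by norm_num)
  -- Since `0 ≤ K ≤ M`, the second moment is at most `M` times the first.
  have hvar1 : ∀ i, Var[fun ω => K n (X i ω); P] ≤ M n * e := fun i => by
    refine (variance_le_expectation_sq (hmeas i).aestronglyMeasurable).trans ?_
    rw [he, ← hX.integral_comp (hK n) i, ← integral_const_mul]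
    refine integral_mono (hL2 i).integrable_sq ((hint i).const_mul _) fun ω => ?_
    simp only [Pi.pow_apply, sq]
    exact mul_le_mul_of_nonneg_right (hn _).2 (hn _).1
  set U : Ω → ℝ := fun ω => 1 / (n : ℝ) * ∑ i ∈ Finset.range n, K n (X i ω) with hU
  have hUL2 : MemLp U 2 P :=
    (memLp_finsetSum (Finset.range n) fun i _ => hL2 i).const_mul (1 / (n : ℝ))
  have hmean : ∫ ω, U ω ∂P = e := by
    rw [hU, integral_const_mul, integral_finsetSum _ fun i _ => hint i]
    simp_rw [hX.integral_comp (hK n)]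
    rw [Finset.sum_const, Finset.card_range, nsmul_eq_mul, ← he]
    field_simp
  have hvar : Var[U; P] ≤ M n / n * e := by
    have hind := hX.indep.comp (fun _ => K n) fun _ => hK n
    have hs := IndepFun.variance_sum (μ := P) (X := fun i ω => K n (X i ω))
      (s := Finset.range n) (fun i _ => hL2 i) fun i _ j _ hij => hind.indepFun hij
    rw [Finset.sum_fn] at hs
    rw [hU, variance_const_mul, hs]
    have h3 : ∑ i ∈ Finset.range n, Var[fun ω => K n (X i ω); P] ≤ n * (M n * e) := by
      refine (Finset.sum_le_sum fun i _ => hvar1 i).trans (le_of_eq ?_)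
      rw [Finset.sum_const, Finset.card_range, nsmul_eq_mul]
    refine (mul_le_mul_of_nonneg_left h3 (by positivity)).trans (le_of_eq ?_)
    field_simp
  -- Half of `ε` absorbs the bias `|e - y|`; Chebyshev's inequality handles the other half.
  calc P {ω | ε ≤ |U ω - y|} ≤ P {ω | ε / 2 ≤ |U ω - ∫ ω, U ω ∂P|} := by
        refine measure_mono fun ω hω => ?_
        rw [mem_ofPred_eq] at hω ⊢
        rw [hmean]
        rw [Real.dist_eq] at hyn
        have := abs_sub_le (U ω) e y
        linarith
    _ ≤ ENNReal.ofReal (Var[U; P] / (ε / 2) ^ 2) := meas_ge_le_variance_div_sq hUL2 (by positivity)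
    _ ≤ _ := ENNReal.ofReal_le_ofReal (by gcongr)

end IsRandomSample

/-! ### Smoothing sequences -/

namespace IsSmoothingSeq

variable {b : ℕ → ℝ}

theorem tendsto_zero (hb : IsSmoothingSeq b) : Tendsto b atTop (𝓝 0) :=
  tendsto_of_tendsto_of_tendsto_of_le_of_le tendsto_const_nhds hb.tendsto
    (fun n => (hb.pos n).le) fun n => le_add_of_nonneg_right (by have := hb.pos n; positivity)

theorem tendsto_inv (hb : IsSmoothingSeq b) :
    Tendsto (fun n : ℕ => ((n : ℝ) * b n)⁻¹) atTop (𝓝 0) :=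
  tendsto_of_tendsto_of_tendsto_of_le_of_le tendsto_const_nhds hb.tendsto
    (fun n => by have := hb.pos n; positivity) fun n => le_add_of_nonneg_left (hb.pos n).le

theorem div_const (hb : IsSmoothingSeq b) {δ : ℝ} (hδ : 0 < δ) :
    IsSmoothingSeq fun n => b n / δ where
  pos n := div_pos (hb.pos n) hδ
  tendsto := by
    have h := (hb.tendsto_zero.div_const δ).add (hb.tendsto_inv.mul_const δ)
    rw [zero_div, zero_mul, add_zero] at h
    refine h.congr fun n => ?_
    rw [← mul_div_assoc, inv_div, div_eq_mul_inv δ, mul_comm δ]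

theorem tendsto_shape (hb : IsSmoothingSeq b) {c : ℝ} (hc : 0 < c) :
    Tendsto (fun n => c / b n) atTop atTop := by
  have h : Tendsto b atTop (𝓝[>] 0) :=
    tendsto_nhdsWithin_iff.2 ⟨hb.tendsto_zero, Eventually.of_forall hb.pos⟩
  exact (h.inv_tendsto_nhdsGT_zero.const_mul_atTop hc).congr fun n => (div_eq_mul_inv c (b n)).symm

end IsSmoothingSeq

/-! ### Multiplicative bias correction -/

theorem mbc_self {δ ℓ : ℝ} (hδ : δ ∈ Ioo (0 : ℝ) 1) (hℓ : 0 < ℓ) : mbc δ ℓ ℓ = ℓ := by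
  have h : 1 - √δ ≠ 0 := by
    have : √δ < 1 := by rw [Real.sqrt_lt' one_pos]; simpa using hδ.2
    linarith
  rw [mbc, ← Real.rpow_add hℓ, ← add_div, ← sub_eq_add_neg, div_self h, Real.rpow_one]

theorem TendstoInProb.mbc {Ω : Type*} [MeasurableSpace Ω] {P : Measure Ω} {U V : ℕ → Ω → ℝ} {δ ℓ : ℝ} (hδ : δ ∈ Ioo (0 : ℝ) 1) (hℓ : 0 < ℓ)
    (hU : TendstoInProb P U ℓ) (hV : TendstoInProb P V ℓ) :
    TendstoInProb P (fun n ω => mbc δ (U n ω) (V n ω)) ℓ := by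
  have h := (hU.prodMk hV).map (g := fun z : ℝ × ℝ => _root_.mbc δ z.1 z.2) (by
    refine ContinuousAt.mul ?_ ?_
    · exact continuousAt_fst.rpow continuousAt_const (Or.inl hℓ.ne')
    · exact continuousAt_snd.rpow continuousAt_const (Or.inl hℓ.ne'))
  simpa only [mbc_self hδ hℓ] using h

/-! ### Consistency of the estimators and of the test -/

section Estimators

variable {Ω : Type*} [MeasurableSpace Ω] {P : Measure Ω} [IsProbabilityMeasure P]
  {X : ℕ → Ω → ℝ} {f : ℝ → ℝ} {b : ℕ → ℝ} {c : ℝ}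

/-- Consistency of an average of re-normalized truncated gamma kernels. Here `S` is the region of
truncation up to scaling and a null set, and `t` is a bounded part of it near the mode. -/
theorem tendstoInProb_mean_truncated (hX : IsRandomSample P X f) (hb : IsSmoothingSeq b)
    (hc : 0 < c) {R R' S t : Set ℝ} {ℓ y : ℝ} {k : ℕ → ℝ → ℝ}
    (hk : ∀ n, k n = R.indicator fun u =>
      gammaPeak (c / b n) (u / c) / (c * ∫ v in S, gammaPeak (c / b n) v))
    (hR : MeasurableSet R) (hR0 : R ⊆ Ici 0) (hR' : MeasurableSet R')
    (hRR' : ∀ v, c * v ∈ R ↔ v ∈ R') (hRS : R' =ᵐ[volume] S)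
    (hS : MeasurableSet S) (hS0 : S ⊆ Ioi 0) (ht : MeasurableSet t) (htS : t ⊆ S)
    (ht1 : t ∈ 𝓝[S] 1) (htf : volume t ≠ ⊤) (hℓ : 0 < ℓ)
    (hIS : Tendsto (fun a => √a * ∫ v in S, gammaPeak a v) atTop (𝓝 ℓ))
    (hIt : Tendsto (fun a => √a * ∫ v in t, gammaPeak a v) atTop (𝓝 ℓ))
    (hy : Tendsto (fun v => f (c * v)) (𝓝[S] 1) (𝓝 y)) :
    TendstoInProb P (fun n ω => 1 / (n : ℝ) * ∑ i ∈ Finset.range n, k n (X i ω)) y := by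
  have hshape := hb.tendsto_shape hc
  refine hX.tendstoInProb_mean (M := fun n => 1 / (c * ∫ v in S, gammaPeak (c / b n) v)) ?_ ?_ ?_ ?_
  · intro n
    rw [hk n]
    exact (((measurable_gammaPeak _).comp (by fun_prop)).div_const _).indicator hR
  · filter_upwards with n u
    have ha : 0 < c / b n := div_pos hc (hb.pos n)
    have hI : 0 ≤ c * ∫ v in S, gammaPeak (c / b n) v :=
      mul_nonneg hc.le (setIntegral_nonneg hS fun v hv => gammaPeak_nonneg (hS0 hv).le)
    rw [hk n]
    by_cases hu : u ∈ R
    · have hu0 : 0 ≤ u / c := div_nonneg (hR0 hu) hc.le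
      rw [indicator_of_mem hu]
      exact ⟨div_nonneg (gammaPeak_nonneg hu0) hI,
        div_le_div_of_nonneg_right (gammaPeak_le_one ha hu0) hI⟩
    · rw [indicator_of_notMem hu]
      exact ⟨le_rfl, by positivity⟩
  -- With `a = c/b ≥ 1` and `I` the normalizing integral, `b √a ≤ b a = c` gives `1 / (c I n) ≤ (n
  -- b)⁻¹ / (√a I)`, where `√a I → ℓ > 0`.
  · have h1 : Tendsto (fun n => 1 / (√(c / b n) * ∫ v in S, gammaPeak (c / b n) v)) atTop
        (𝓝 (1 / ℓ)) := (tendsto_const_nhds (x := (1 : ℝ))).div (hIS.comp hshape) hℓ.ne'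
    have h2 := hb.tendsto_inv.mul h1
    rw [zero_mul] at h2
    refine squeeze_zero' ?_ ?_ h2
    · filter_upwards with n
      have hI : 0 ≤ ∫ v in S, gammaPeak (c / b n) v :=
        setIntegral_nonneg hS fun v hv => gammaPeak_nonneg (hS0 hv).le
      positivity
    · filter_upwards [hshape.eventually_ge_atTop 1, (hIS.comp hshape).eventually_const_lt hℓ,
        eventually_gt_atTop 0] with n ha hI hn
      have hn' : (0 : ℝ) < n := by exact_mod_cast hn
      have hbn := hb.pos n
      have hs1 : 1 ≤ √(c / b n) := Real.one_le_sqrt.2 ha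
      have hs0 : 0 < √(c / b n) := by linarith
      simp only [Function.comp_apply] at hI
      have hI' : 0 < ∫ v in S, gammaPeak (c / b n) v := (mul_pos_iff_of_pos_left hs0).1 hI
      have hs2 : √(c / b n) ≤ c / b n := Real.sqrt_le_self_iff.2 (Or.inr ha)
      have hs3 : b n * √(c / b n) ≤ c := by rwa [le_div_iff₀ hbn, mul_comm] at hs2
      generalize (∫ v in S, gammaPeak (c / b n) v) = I at *
      rw [div_div, inv_eq_one_div, div_mul_div_comm, one_mul]
      refine one_div_le_one_div_of_le (by positivity) ?_
      calc (n : ℝ) * b n * (√(c / b n) * I) = n * I * (b n * √(c / b n)) := by ring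
        _ ≤ n * I * c := by gcongr
        _ = c * I * n := by ring
  · have hg : IntegrableOn (fun v => f (c * v)) S :=
      (hX.integrable_density.comp_mul_left' hc.ne').integrableOn
    refine ((tendsto_setIntegral_gammaPeak_div_mul hS hS0 ht htS ht1 htf hℓ hIS hIt hg hy).comp
      hshape).congr fun n => ?_
    have h1 := Measure.integral_comp_mul_left (fun u => k n u * f u) c
    rw [abs_of_pos (inv_pos.2 hc), smul_eq_mul] at h1
    have h2 : (∫ u, k n u * f u) = c * ∫ v, k n (c * v) * f (c * v) := by
      rw [h1, mul_inv_cancel_left₀ hc.ne']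
    have h3 : (fun v => c * (k n (c * v) * f (c * v))) = R'.indicator fun v =>
        gammaPeak (c / b n) v / (∫ w in S, gammaPeak (c / b n) w) * f (c * v) := by
      ext v
      rw [hk n]
      by_cases hv : v ∈ R'
      · rw [indicator_of_mem hv, indicator_of_mem ((hRR' v).2 hv), mul_div_cancel_left₀ _ hc.ne']
        field_simp
      · rw [indicator_of_notMem hv, indicator_of_notMem (mt (hRR' v).1 hv), zero_mul, mul_zero]
    rw [h2, ← integral_const_mul, h3, integral_indicator hR', setIntegral_congr_set hRS]
    rfl

theorem sqrt_pi_div_half_pos : 0 < √(Real.pi / (1 / 2)) / 2 := by positivity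

theorem tendstoInProb_fHatMinus (hX : IsRandomSample P X f) (hb : IsSmoothingSeq b)
    (hc : 0 < c) {y : ℝ} (hy : Tendsto f (𝓝[<] c) (𝓝 y)) :
    TendstoInProb P (fun n ω => fHatMinus c n (b n) fun i => X i ω) y := by
  refine tendstoInProb_mean_truncated (R := Ico 0 c) (R' := Ico 0 1) (S := Ioo 0 1)
    (t := Ioo 0 1) hX hb hc
    (fun n => kernelMinus_eq (hb.pos n) hc) measurableSet_Ico (fun x hx => hx.1) measurableSet_Ico
    (fun v => ?_) Ioo_ae_eq_Ico.symm measurableSet_Ioo (fun x hx => hx.1) measurableSet_Ioo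
    subset_rfl self_mem_nhdsWithin measure_Ioo_lt_top.ne sqrt_pi_div_half_pos
    tendsto_sqrt_mul_integral_gammaPeak_Ioo tendsto_sqrt_mul_integral_gammaPeak_Ioo
    (hy.comp (tendsto_nhdsWithin_iff.2 ⟨?_, ?_⟩))
  · rw [mem_Ico, mem_Ico, mul_nonneg_iff_of_pos_left hc, mul_lt_iff_lt_one_right hc]
  · have h : Tendsto (fun v : ℝ => c * v) (𝓝 1) (𝓝 (c * 1)) := tendsto_id.const_mul c
    rw [mul_one] at h
    exact h.mono_left nhdsWithin_le_nhds
  · filter_upwards [self_mem_nhdsWithin] with v hv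
    exact (mul_lt_iff_lt_one_right hc).2 hv.2

theorem tendstoInProb_fHatPlus (hX : IsRandomSample P X f) (hb : IsSmoothingSeq b)
    (hc : 0 < c) {y : ℝ} (hy : Tendsto f (𝓝[>] c) (𝓝 y)) :
    TendstoInProb P (fun n ω => fHatPlus c n (b n) fun i => X i ω) y := by
  refine tendstoInProb_mean_truncated (R := Ici c) (R' := Ici 1) (S := Ioi 1) (t := Ioc 1 2)
    hX hb hc
    (fun n => kernelPlus_eq (hb.pos n) hc) measurableSet_Ici (fun x hx => hc.le.trans hx)
    measurableSet_Ici (fun v => ?_) Ioi_ae_eq_Ici.symm measurableSet_Ioi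
    (fun x hx => mem_Ioi.2 (zero_lt_one.trans hx)) measurableSet_Ioc Ioc_subset_Ioi_self
    (Ioc_mem_nhdsGT one_lt_two) measure_Ioc_lt_top.ne sqrt_pi_div_half_pos
    tendsto_sqrt_mul_integral_gammaPeak_Ioi tendsto_sqrt_mul_integral_gammaPeak_Ioc
    (hy.comp (tendsto_nhdsWithin_iff.2 ⟨?_, ?_⟩))
  · rw [mem_Ici, mem_Ici, le_mul_iff_one_le_right hc]
  · have h : Tendsto (fun v : ℝ => c * v) (𝓝 1) (𝓝 (c * 1)) := tendsto_id.const_mul c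
    rw [mul_one] at h
    exact h.mono_left nhdsWithin_le_nhds
  · filter_upwards [self_mem_nhdsWithin] with v hv
    exact (lt_mul_iff_one_lt_right hc).2 hv

/-- The weights undo the renormalization of each truncated kernel, so consistency carries over from
the one-sided estimators. -/
theorem fHat_eq {b : ℝ} (n : ℕ) (x : ℕ → ℝ) (hl : lowerGamma (c / b + 1) (c / b) ≠ 0)
    (hu : upperGamma (c / b + 1) (c / b) ≠ 0) (hG : Real.Gamma (c / b + 1) ≠ 0) :
    fHat c n b x =
      lowerGamma (c / b + 1) (c / b) / Real.Gamma (c / b + 1) * fHatMinus c n b x +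
      upperGamma (c / b + 1) (c / b) / Real.Gamma (c / b + 1) * fHatPlus c n b x := by
  have h1 : ∀ i, kernelL c b c (x i) =
      lowerGamma (c / b + 1) (c / b) / Real.Gamma (c / b + 1) * kernelMinus c b c (x i) := by
    intro i; rw [kernelMinus]; field_simp
  have h2 : ∀ i, kernelU c b c (x i) =
      upperGamma (c / b + 1) (c / b) / Real.Gamma (c / b + 1) * kernelPlus c b c (x i) := by
    intro i; rw [kernelPlus]; field_simp
  simp_rw [fHat, fHatMinus, fHatPlus, h1, h2, Finset.sum_add_distrib, ← Finset.mul_sum]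
  ring

/-- The two sides of the peak have the same Gaussian limit, so each carries asymptotically half of
the complete gamma integral. -/
theorem tendsto_lowerGamma_div_Gamma :
    Tendsto (fun a => lowerGamma (a + 1) a / Real.Gamma (a + 1)) atTop (𝓝 (1 / 2)) := by
  have hm := tendsto_sqrt_mul_integral_gammaPeak_Ioo
  have hp := tendsto_sqrt_mul_integral_gammaPeak_Ioi
  have hℓ := sqrt_pi_div_half_pos
  generalize √(Real.pi / (1 / 2)) / 2 = ℓ at *
  have h := hm.div (hm.add hp) (by positivity)
  rw [show ℓ / (ℓ + ℓ) = 1 / 2 by field_simp; norm_num] at h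
  refine h.congr' ?_
  filter_upwards [eventually_gt_atTop 0] with a ha
  have hs : 0 < √a := Real.sqrt_pos.2 ha
  have hq : a ^ (a + 1) * Real.exp (-a) ≠ 0 := by positivity
  rw [← lowerGamma_add_upperGamma (by linarith : 0 < a + 1) ha.le, lowerGamma_eq ha,
    upperGamma_eq ha, ← mul_add, mul_div_mul_left _ _ hq, Pi.div_apply, ← mul_add,
    mul_div_mul_left _ _ hs.ne']

theorem tendsto_upperGamma_div_Gamma :
    Tendsto (fun a => upperGamma (a + 1) a / Real.Gamma (a + 1)) atTop (𝓝 (1 / 2)) := by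
  have h := tendsto_lowerGamma_div_Gamma.const_sub 1
  rw [show (1 : ℝ) - 1 / 2 = 1 / 2 by norm_num] at h
  refine h.congr' ?_
  filter_upwards [eventually_gt_atTop 0] with a ha
  have hG := (Real.Gamma_pos_of_pos (by linarith : 0 < a + 1)).ne'
  rw [sub_eq_iff_eq_add, ← add_div, add_comm,
    lowerGamma_add_upperGamma (by linarith : 0 < a + 1) ha.le, div_self hG]

theorem tendstoInProb_fHat (hX : IsRandomSample P X f) (hb : IsSmoothingSeq b) (hc : 0 < c)
    {p m : ℝ} (hm : Tendsto f (𝓝[<] c) (𝓝 m)) (hp : Tendsto f (𝓝[>] c) (𝓝 p)) :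
    TendstoInProb P (fun n ω => fHat c n (b n) fun i => X i ω) ((p + m) / 2) := by
  have hl := tendsto_lowerGamma_div_Gamma.comp (hb.tendsto_shape hc)
  have hu := tendsto_upperGamma_div_Gamma.comp (hb.tendsto_shape hc)
  have h := (((TendstoInProb.const (P := P) hl).prodMk (TendstoInProb.const (P := P) hu)).prodMk
    ((tendstoInProb_fHatMinus hX hb hc hm).prodMk (tendstoInProb_fHatPlus hX hb hc hp))).map
    (g := fun z : (ℝ × ℝ) × ℝ × ℝ => z.1.1 * z.2.1 + z.1.2 * z.2.2) (by fun_prop)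
  rw [show (p + m) / 2 = 1 / 2 * m + 1 / 2 * p by ring]
  refine h.congr' ?_
  filter_upwards [hl.eventually_ne (by norm_num : (1 / 2 : ℝ) ≠ 0),
    hu.eventually_ne (by norm_num : (1 / 2 : ℝ) ≠ 0)] with n h1 h2
  simp only [Function.comp_apply, ne_eq, div_eq_zero_iff, not_or] at h1 h2
  ext ω
  exact (fHat_eq n _ h1.1 h2.1 h1.2).symm

/-- With `s = √δ`, squaring the numerator inequality turns it into `8 s⁴ < (1 + s³)² (1 + s²)`. This
is the product of two AM-GM bounds, `4 s³ ≤ (1 + s³)²` and `2 s < 1 + s²`, the latter strict as `s <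
1`. -/
theorem varFactor_pos {δ : ℝ} (hδ : δ ∈ Ioo (0 : ℝ) 1) : 0 < varFactor δ := by
  obtain ⟨h0, h1⟩ := hδ
  have hs : √δ < 1 := by rw [Real.sqrt_lt' one_pos]; simpa using h1
  have hs0 : 0 < √δ := Real.sqrt_pos.2 h0
  have hsq : √δ ^ 2 = δ := Real.sq_sqrt h0.le
  have h32 : δ ^ (3 / 2 : ℝ) = √δ ^ 3 := by
    rw [Real.sqrt_eq_rpow, ← Real.rpow_natCast, ← Real.rpow_mul h0.le]
    norm_num
  refine div_pos (sub_pos.2 ?_) (mul_pos (Real.sqrt_pos.2 (by linarith))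
    (pow_pos (by linarith) 2))
  rw [h32]
  refine lt_of_pow_lt_pow_left₀ 2 (by positivity) ?_
  rw [mul_pow, mul_pow, mul_pow, Real.sq_sqrt (by norm_num), Real.sq_sqrt (by linarith)]
  generalize √δ = s at *
  subst hsq
  have e1 : 4 * s ^ 3 ≤ (1 + s ^ 3) ^ 2 := by nlinarith [sq_nonneg (1 - s ^ 3)]
  have e2 : 2 * s < 1 + s ^ 2 := by nlinarith [sq_pos_of_pos (sub_pos.2 hs)]
  calc 2 ^ 2 * 2 * (s ^ 2) ^ 2 = 4 * s ^ 3 * (2 * s) := by ring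
    _ < 4 * s ^ 3 * (1 + s ^ 2) := by gcongr
    _ ≤ _ := by gcongr

/-- Consistency of the test for an arbitrary consistent variance estimator. -/
theorem tendsto_measure_lt_abs_testStat {δ j s : ℝ} (hb : ∀ n, 0 < b n) (hj : j ≠ 0) (hs : 0 < s)
    {V : ℕ → Ω → ℝ}
    (hJ : TendstoInProb P (fun n ω => jTilde δ c n (b n) fun i => X i ω) j)
    (hV : TendstoInProb P V s) {B : ℕ → ℝ}
    (hB : B =o[atTop] fun n : ℕ => (n : ℝ) ^ (1 / 2 : ℝ) * b n ^ (1 / 4 : ℝ)) :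
    Tendsto (fun n => P {ω | B n < |testStat δ c n (b n) (fun i => X i ω) (V n ω)|})
      atTop (𝓝 1) := by
  have hss : 0 < √s := Real.sqrt_pos.2 hs
  have h := (hJ.prodMk hV).map (g := fun z : ℝ × ℝ => |z.1 / √z.2|)
    ((continuousAt_fst.div (continuousAt_snd.sqrt) hss.ne').abs)
  have hr : 0 < |j / √s| := abs_pos.2 (div_ne_zero hj hss.ne')
  set r := |j / √s| with hrdef
  -- The level `r/2` separates both sides: the scaled statistic exceeds it with probability tending
  -- to `1`, and the scaled `B n` is eventually at most `r/2`.
  refine h.measure_tendsto_one (Ioi_mem_nhds (half_lt_self hr)) ?_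
  filter_upwards [hB.bound (half_pos hr), eventually_gt_atTop 0] with n hn hn0 ω hω
  have hn' : (0 : ℝ) < n := by exact_mod_cast hn0
  have hbn := hb n
  have hrate : √(n * √(b n)) = (n : ℝ) ^ (1 / 2 : ℝ) * b n ^ (1 / 4 : ℝ) := by
    rw [Real.sqrt_eq_rpow, Real.sqrt_eq_rpow, Real.mul_rpow hn'.le (by positivity),
      ← Real.rpow_mul hbn.le]
    norm_num
  have hpos : 0 < (n : ℝ) ^ (1 / 2 : ℝ) * b n ^ (1 / 4 : ℝ) := by positivity
  rw [mem_Ioi] at hω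
  rw [testStat, hrate, mul_div_assoc, abs_mul, abs_of_pos hpos]
  rw [Real.norm_eq_abs, Real.norm_of_nonneg hpos.le] at hn
  calc B n ≤ |B n| := le_abs_self _
    _ ≤ r / 2 * ((n : ℝ) ^ (1 / 2 : ℝ) * b n ^ (1 / 4 : ℝ)) := hn
    _ < _ := by rw [mul_comm]; gcongr

end Estimators

theorem proposition3 {Ω : Type*} [MeasurableSpace Ω] (P : Measure Ω) [IsProbabilityMeasure P]
    (X : ℕ → Ω → ℝ) (f : ℝ → ℝ) (c δ : ℝ) (b : ℕ → ℝ)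
    (hc : 0 < c) (hδ : δ ∈ Ioo (0 : ℝ) 1)
    (hX : IsRandomSample P X f) (hf : IsPiecewiseSmooth f c) (hb : IsSmoothingSeq b)
    (hJ : densityJump f c ≠ 0)
    (B : ℕ → ℝ)
    (hB : B =o[atTop] fun n : ℕ => (n : ℝ) ^ (1 / 2 : ℝ) * b n ^ (1 / 4 : ℝ)) :
    (∀ V : ℕ → Ω → ℝ, (∀ n, AEMeasurable (V n) P) →
      TendstoInMeasure P V atTop (fun _ => asympVar δ f c) →
      Tendsto (fun n => P {ω | B n < |testStat δ c n (b n) (fun i => X i ω) (V n ω)|})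
        atTop (𝓝 1)) ∧
    Tendsto (fun n => P {ω | B n < |testStat δ c n (b n) (fun i => X i ω)
        (vTilde₁ δ c n (b n) (fun i => X i ω))|}) atTop (𝓝 1) ∧
    Tendsto (fun n => P {ω | B n < |testStat δ c n (b n) (fun i => X i ω)
        (vTilde₂ δ c n (b n) (fun i => X i ω))|}) atTop (𝓝 1) := by
  have hbδ := hb.div_const hδ.1
  have hm := TendstoInProb.mbc hδ hf.left_pos (tendstoInProb_fHatMinus hX hb hc hf.tendsto_left)
    (tendstoInProb_fHatMinus hX hbδ hc hf.tendsto_left)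
  have hp := TendstoInProb.mbc hδ hf.right_pos (tendstoInProb_fHatPlus hX hb hc hf.tendsto_right)
    (tendstoInProb_fHatPlus hX hbδ hc hf.tendsto_right)
  have hj : TendstoInProb P (fun n ω => jTilde δ c n (b n) fun i => X i ω) (densityJump f c) :=
    (hp.prodMk hm).map (g := fun z : ℝ × ℝ => z.1 - z.2) (by fun_prop)
  have hs : 0 < asympVar δ f c := by
    have := hf.left_pos
    have := hf.right_pos
    have := varFactor_pos hδ
    have := Real.pi_pos
    unfold asympVar
    positivity
  have main : ∀ V : ℕ → Ω → ℝ, TendstoInProb P V (asympVar δ f c) → _ := fun V hV =>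
    tendsto_measure_lt_abs_testStat hb.pos hJ hs hj hV hB
  refine ⟨fun V _ hV => main V (.of_tendstoInMeasure hV), main _ ?_, main _ ?_⟩
  · exact (hp.prodMk hm).map
      (g := fun z : ℝ × ℝ => varFactor δ * ((z.1 + z.2) / (√Real.pi * √c))) (by fun_prop)
  -- At the jump `fHat` tends to the average of the two one-sided limits; the factor `2` in
  -- `vTilde₂` restores their sum.
  · have h := (tendstoInProb_fHat hX hb hc hf.tendsto_left hf.tendsto_right).map
      (g := fun z : ℝ => varFactor δ * (2 * z / (√Real.pi * √c))) (by fun_prop)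
    rwa [mul_div_cancel₀ _ two_ne_zero] at h
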